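/- Let $\beta$ be the Kertz bound, i.e. the unique number $\beta \in (0,1)$ with $$\int_0^1 \bigl[(\beta^{-1}-1) - y(\log y - 1)\bigr]^{-1}\,dy = 1$$ (existence and uniqueness of this solution being part of the claim; $\beta \approx 0.745$). Let $\mathbf X = \{X_1,\dots,X_n\}$ be independent, identically distributed random variables with values in $[0,\infty)$. Put $\mathsf{MAX}(\mathbf X) = \mathbb E[\max_{i} X_i]\in[0,\infty]$ and let $\mathsf{OPT}(\mathbf X)\in[0,\infty]$ be the supremum of the expected rewards of online policies when the variables arrive in a uniformly random order, independent of their values: on each arrival the policy, which knows the distributions, sees the identity and the value of the arriving variable and, on the basis of what it has seen so far, either stops and receives that value or rejects it irrevocably and continues; it receives $0$ if it rejects all variables. Then $$\mathsf{OPT}(\mathbf X) \ge \beta\cdot \mathsf{MAX}(\mathbf X).$$ No smallness assumption is made on the common distribution. -/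

import Mathlib

open MeasureTheory ProbabilityTheory
open scoped NNReal ENNReal

namespace ProphetInequality

/-- `β` is the Kertz bound: the number in `(0, 1)` solving Kertz's equation
`∫₀¹ [(β⁻¹ - 1) - y (log y - 1)]⁻¹ dy = 1`. For `0 < β < 1` the integrand is continuous and
bounded on `[0, 1]`, the denominator being at least `β⁻¹ - 1 > 0` there. -/
def IsKertzBound (β : ℝ) : Prop :=
  0 < β ∧ β < 1 ∧ ∫ y in (0 : ℝ)..1, ((β⁻¹ - 1) - y * (Real.log y - 1))⁻¹ = 1

/-- An online policy for `n` boxes arriving in a random order. When the box with arrival index `t`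
has been opened, the policy knows the identities and the contents of the boxes with arrival indices
`0, …, t`, and nothing else. It stops there, keeping the content of the current box, when this
history lies in the (measurable) set `accept t`, and rejects the box otherwise. -/
structure Policy (n : ℕ) where
  /-- The histories after which the box with arrival index `t` is accepted. -/
  accept : (t : Fin n) → Set (Fin ((t : ℕ) + 1) → Fin n × ℝ≥0)
  measurableSet_accept : ∀ t, MeasurableSet (accept t)

/-- The history available when the box with arrival index `t` has been opened, if the `s`-th box to
arrive is the box `π s` and box `i` contains `x i`. -/
def history {n : ℕ} (π : Equiv.Perm (Fin n)) (x : Fin n → ℝ≥0) (t : Fin n) :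
    Fin ((t : ℕ) + 1) → Fin n × ℝ≥0 :=
  fun s => (π (Fin.castLE t.isLt s), x (π (Fin.castLE t.isLt s)))

/-- The policy stops at arrival index `t`: it accepts there and has rejected all earlier boxes. -/
def Policy.StopsAt {n : ℕ} (P : Policy n) (π : Equiv.Perm (Fin n)) (x : Fin n → ℝ≥0)
    (t : Fin n) : Prop :=
  history π x t ∈ P.accept t ∧ ∀ s : Fin n, s < t → history π x s ∉ P.accept s

open Classical in
/-- The reward of a policy for the arrival order `π` and the contents `x`: the content of the box at
which it stops, and `0` if it rejects all boxes (at most one summand is not `0`). -/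
noncomputable def Policy.reward {n : ℕ} (P : Policy n) (π : Equiv.Perm (Fin n))
    (x : Fin n → ℝ≥0) : ℝ≥0∞ :=
  ∑ t : Fin n, if P.StopsAt π x t then (x (π t) : ℝ≥0∞) else 0

/-- The expected reward of a policy when the boxes contain the random variables `X i` and arrive in
a uniformly random order that is independent of their contents. -/
noncomputable def Policy.expectedReward {n : ℕ} (P : Policy n) {Ω : Type*} [MeasurableSpace Ω]
    (μ : Measure Ω) (X : Fin n → Ω → ℝ≥0) : ℝ≥0∞ :=
  ((n.factorial : ℕ) : ℝ≥0∞)⁻¹ *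
    ∑ π : Equiv.Perm (Fin n), ∫⁻ ω, P.reward π (fun i => X i ω) ∂μ

/-- `OPT(X)`: the reward of the optimal online policy in the uniform random order. -/
noncomputable def OPT {n : ℕ} {Ω : Type*} [MeasurableSpace Ω] (μ : Measure Ω)
    (X : Fin n → Ω → ℝ≥0) : ℝ≥0∞ :=
  ⨆ P : Policy n, P.expectedReward μ X

/-- `MAX(X) = E[maxᵢ Xᵢ]`: the reward of the prophet. -/
noncomputable def MAX {n : ℕ} {Ω : Type*} [MeasurableSpace Ω] (μ : Measure Ω)
    (X : Fin n → Ω → ℝ≥0) : ℝ≥0∞ :=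
  ∫⁻ ω, ⨆ i, (X i ω : ℝ≥0∞) ∂μ

end ProphetInequality

/-! Write `c = β⁻¹ - 1` and let `G` be the common tail function. Backward induction gives the value
`V k` of optimally stopping `k` copies: `V 0 = 0` and `V (k+1) = E max(Y, V k) = V k + D (V k)`,
where `D v` is the integral of `G` over `(v, ∞)`. The prophet gets the integral of `1 - (1 - G)^n`
over `(0, ∞)`.

On each interval `(V k, V (k+1)]` the convex power `(1 - G)^n` is bounded below by its tangent at a
point `p k`. If `p k ^ (n-1) = ρ (k+1)` and `(n-1) * p k ^ n ≤ c + n * ρ k`, with `ρ 0 = 0` and `ρ n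
= 1`, these bounds telescope to `MAX ≤ (1 + c) * V n = β⁻¹ * V n` (`integral_tail_max_le`).

As `n → ∞`, equality in this recursion becomes `r' = c - r (log r - 1)`, and Kertz's equation says
that the solution climbs from `0` to `1` in unit time. Its values at the times `k / n` satisfy the
inequality for every `n ≥ 2` (`kertzTime_comparison`, `exists_kertz_levels`). Finally `V n` is
attained by a threshold policy, whatever the arrival order (`lintegral_thresholdPolicy_reward`). -/

namespace ProphetInequality

/-! ### Kertz's equation: existence and uniqueness of the bound. -/

/-- The integrand in Kertz's equation, with `c` in place of `β⁻¹ - 1`. -/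
noncomputable def kertzKernel (c y : ℝ) : ℝ := (c - y * (Real.log y - 1))⁻¹

/-- The derivative of `y (log y - 1)` is `log y ≤ 0`; the proof uses `log u ≥ 1 - 1/u` at `u = y /
z` instead. -/
lemma sub_mul_log_mono {y z : ℝ} (hy : 0 < y) (hyz : y ≤ z) (hz : z ≤ 1) :
    z * (Real.log z - 1) ≤ y * (Real.log y - 1) := by
  have hz0 : 0 < z := hy.trans_le hyz
  have h := Real.one_sub_inv_le_log_of_pos (div_pos hy hz0)
  rw [Real.log_div hy.ne' hz0.ne', inv_div] at h
  have h2 := mul_le_mul_of_nonneg_left h hy.le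
  have h3 : y * (1 - z / y) = y - z := by field_simp
  have h4 : Real.log z ≤ 0 := Real.log_nonpos hz0.le hz
  nlinarith [mul_nonneg (sub_nonneg.2 hyz) (neg_nonneg.2 h4)]

lemma le_neg_mul_log_sub {y : ℝ} (hy : 0 ≤ y) (hy1 : y ≤ 1) : y ≤ -(y * (Real.log y - 1)) := by
  nlinarith [mul_nonneg hy (neg_nonneg.2 (Real.log_nonpos hy hy1))]

lemma kertzDenom_pos {c y : ℝ} (hc : 0 < c) (hy : 0 ≤ y) (hy1 : y ≤ 1) :
    0 < c - y * (Real.log y - 1) := by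
  linarith [le_neg_mul_log_sub hy hy1]

lemma kertzKernel_pos {c y : ℝ} (hc : 0 < c) (hy : 0 ≤ y) (hy1 : y ≤ 1) :
    0 < kertzKernel c y := inv_pos.2 (kertzDenom_pos hc hy hy1)

lemma continuous_kertzDenom (c : ℝ) : Continuous fun y : ℝ => c - y * (Real.log y - 1) := by
  have h : (fun y : ℝ => c - y * (Real.log y - 1)) = fun y => c - (y * Real.log y - y) := by
    ext y; ring
  rw [h]
  exact continuous_const.sub (Real.continuous_mul_log.sub continuous_id)

lemma measurable_kertzKernel (c : ℝ) : Measurable (kertzKernel c) :=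
  (continuous_kertzDenom c).measurable.inv

lemma continuousAt_kertzKernel {c y : ℝ} (hc : 0 < c) (hy : 0 ≤ y) (hy1 : y ≤ 1) :
    ContinuousAt (kertzKernel c) y :=
  (continuous_kertzDenom c).continuousAt.inv₀ (kertzDenom_pos hc hy hy1).ne'

lemma continuousOn_kertzKernel {c : ℝ} (hc : 0 < c) :
    ContinuousOn (kertzKernel c) (Set.Icc 0 1) :=
  fun _ hy => (continuousAt_kertzKernel hc hy.1 hy.2).continuousWithinAt

lemma intervalIntegrable_kertzKernel {c a b : ℝ} (hc : 0 < c) (ha : a ∈ Set.Icc (0 : ℝ) 1)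
    (hb : b ∈ Set.Icc (0 : ℝ) 1) : IntervalIntegrable (kertzKernel c) volume a b :=
  ((continuousOn_kertzKernel hc).mono (Set.uIcc_subset_Icc ha hb)).intervalIntegrable

lemma integral_kertzKernel_lt {c d : ℝ} (hc : 0 < c) (hcd : c < d) :
    ∫ y in (0 : ℝ)..1, kertzKernel d y < ∫ y in (0 : ℝ)..1, kertzKernel c y := by
  have hd := hc.trans hcd
  refine intervalIntegral.integral_lt_integral_of_continuousOn_of_le_of_exists_lt one_pos
    (continuousOn_kertzKernel hd) (continuousOn_kertzKernel hc) (fun y hy => ?_)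
    ⟨1, by simp, ?_⟩
  · exact inv_anti₀ (kertzDenom_pos hc hy.1.le hy.2) (by linarith)
  · exact inv_strictAnti₀ (kertzDenom_pos hc zero_le_one le_rfl) (by linarith)

lemma continuousOn_integral_kertzKernel :
    ContinuousOn (fun c => ∫ y in (0 : ℝ)..1, kertzKernel c y) (Set.Ioi 0) := by
  intro c (hc : 0 < c)
  refine ContinuousAt.continuousWithinAt ?_
  refine intervalIntegral.continuousAt_of_dominated_interval (bound := fun _ => (c / 2)⁻¹)
    (.of_forall fun d => (measurable_kertzKernel d).aestronglyMeasurable) ?_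
    intervalIntegrable_const ?_
  · filter_upwards [eventually_gt_nhds (half_lt_self hc)] with d hd
    refine .of_forall fun y hy => ?_
    rw [Set.uIoc_of_le zero_le_one] at hy
    have hd0 : 0 < d := (half_pos hc).trans hd
    rw [Real.norm_of_nonneg (kertzKernel_pos hd0 hy.1.le hy.2).le]
    refine inv_anti₀ (half_pos hc) ?_
    linarith [le_neg_mul_log_sub hy.1.le hy.2, hy.1]
  · refine .of_forall fun y hy => ?_
    rw [Set.uIoc_of_le zero_le_one] at hy
    exact (continuousAt_id.sub continuousAt_const).inv₀ (kertzDenom_pos hc hy.1.le hy.2).ne'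

lemma integral_kertzKernel_one_le : ∫ y in (0 : ℝ)..1, kertzKernel 1 y ≤ 1 := by
  have h : ∫ y in (0 : ℝ)..1, kertzKernel 1 y ≤ ∫ _ in (0 : ℝ)..1, (1 : ℝ) := by
    refine intervalIntegral.integral_mono_on zero_le_one
      (intervalIntegrable_kertzKernel one_pos (by simp) (by simp)) intervalIntegrable_const
      fun y hy => inv_le_one_of_one_le₀ ?_
    linarith [le_neg_mul_log_sub hy.1 hy.2, hy.1]
  simpa using h

/-- For `δ = exp (-15)` and `y` in `[δ, 1]`, `δ ≤ y ≤ y (1 - log y)`, so the kernel is at least `1 /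
(2 y (1 - log y))`, with primitive `-log (1 - log y) / 2`. The exponent makes `1 - log δ = 16 = 2 ^
4`, and `log 16 / 2 ≥ 1`. -/
lemma one_le_integral_kertzKernel_exp :
    1 ≤ ∫ y in (0 : ℝ)..1, kertzKernel (Real.exp (-15)) y := by
  set δ := Real.exp (-15) with hδ
  have hδ0 : 0 < δ := Real.exp_pos _
  have hδ1 : δ ≤ 1 := by rw [hδ, Real.exp_le_one_iff]; norm_num
  have hden : ∀ y ∈ Set.Icc δ 1, 0 < 1 - Real.log y := fun y hy => by
    linarith [Real.log_nonpos (hδ0.le.trans hy.1) hy.2]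
  have hcont : ContinuousOn (fun y : ℝ => y⁻¹ / (1 - Real.log y) / 2) (Set.Icc δ 1) := by
    intro y hy
    have hy0 : y ≠ 0 := (hδ0.trans_le hy.1).ne'
    exact (((continuousAt_inv₀ hy0).div (continuousAt_const.sub (Real.continuousAt_log hy0))
      (hden y hy).ne').div_const 2).continuousWithinAt
  have hint : IntervalIntegrable (fun y : ℝ => y⁻¹ / (1 - Real.log y) / 2) volume δ 1 :=
    hcont.intervalIntegrable_of_Icc hδ1
  have hval : ∫ y in δ..1, y⁻¹ / (1 - Real.log y) / 2 = Real.log 16 / 2 := by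
    rw [intervalIntegral.integral_eq_sub_of_hasDerivAt
      (f := fun y => -Real.log (1 - Real.log y) / 2) ?_ hint]
    · simp only [Real.log_one, hδ, Real.log_exp]; norm_num; ring
    · intro y hy
      rw [Set.uIcc_of_le hδ1] at hy
      have hy0 : y ≠ 0 := (hδ0.trans_le hy.1).ne'
      have h := ((((Real.hasDerivAt_log hy0).const_sub 1).log (hden y hy).ne').neg).div_const 2
      refine h.congr_deriv ?_
      rw [neg_div, neg_div, neg_div, neg_neg]
  have hlog : 2 ≤ Real.log 16 := by
    have h16 : (16 : ℝ) = 2 ^ 4 := by norm_num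
    rw [h16, Real.log_pow]
    push_cast
    linarith [Real.log_two_gt_d9]
  have hsplit : ∫ y in δ..1, kertzKernel δ y ≤ ∫ y in (0 : ℝ)..1, kertzKernel δ y := by
    refine intervalIntegral.integral_mono_interval hδ0.le hδ1 le_rfl ?_
      (intervalIntegrable_kertzKernel hδ0 (by simp) (by simp))
    refine (ae_restrict_iff' measurableSet_Ioc).2 (.of_forall fun y hy => ?_)
    exact (kertzKernel_pos hδ0 hy.1.le hy.2).le
  have hle : ∫ y in δ..1, y⁻¹ / (1 - Real.log y) / 2 ≤ ∫ y in δ..1, kertzKernel δ y := by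
    refine intervalIntegral.integral_mono_on hδ1 hint
      (intervalIntegrable_kertzKernel hδ0 ⟨hδ0.le, hδ1⟩ (by simp)) fun y hy => ?_
    have hy0 : 0 < y := hδ0.trans_le hy.1
    have h1 : y⁻¹ / (1 - Real.log y) / 2 = (2 * -(y * (Real.log y - 1)))⁻¹ := by
      have := (hden y hy).ne'
      rw [show 2 * -(y * (Real.log y - 1)) = y * (1 - Real.log y) * 2 by ring, mul_inv, mul_inv]
      rfl
    rw [h1]
    refine inv_anti₀ (kertzDenom_pos hδ0 hy0.le hy.2) ?_
    linarith [le_neg_mul_log_sub hy0.le hy.2, hy.1]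
  linarith

theorem existsUnique_isKertzBound : ∃! β : ℝ, IsKertzBound β := by
  have hδ0 := Real.exp_pos (-15)
  have hδ1 : Real.exp (-15) ≤ 1 := by rw [Real.exp_le_one_iff]; norm_num
  obtain ⟨c, hc, hc1⟩ := intermediate_value_Icc' hδ1
    (continuousOn_integral_kertzKernel.mono fun x hx => hδ0.trans_le hx.1)
    ⟨integral_kertzKernel_one_le, one_le_integral_kertzKernel_exp⟩
  have hc0 : 0 < c := hδ0.trans_le hc.1
  refine ⟨(1 + c)⁻¹, ⟨by positivity, inv_lt_one_of_one_lt₀ (by linarith), ?_⟩, ?_⟩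
  · rw [inv_inv, add_sub_cancel_left]
    exact hc1
  · rintro β ⟨hβ0, hβ1, hβ⟩
    have hd0 : 0 < β⁻¹ - 1 := sub_pos.2 ((one_lt_inv₀ hβ0).2 hβ1)
    have h : β⁻¹ - 1 = c := by
      rcases lt_trichotomy (β⁻¹ - 1) c with h | h | h
      · exact absurd (hc1.trans hβ.symm) (integral_kertzKernel_lt hd0 h).ne
      · exact h
      · exact absurd (hβ.trans hc1.symm) (integral_kertzKernel_lt hc0 h).ne
    rw [← h, add_sub_cancel, inv_inv]

/-! ### The flow of Kertz's equation compared with the discrete recursion. -/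

/-- The time at which the solution of `r' = c - r (log r - 1)`, `r 0 = 0` reaches the level `r`. -/
noncomputable def kertzTime (c r : ℝ) : ℝ := ∫ y in (0 : ℝ)..r, kertzKernel c y

lemma kertzTime_zero (c : ℝ) : kertzTime c 0 = 0 := intervalIntegral.integral_same

lemma continuousOn_kertzTime {c : ℝ} (hc : 0 < c) : ContinuousOn (kertzTime c) (Set.Icc 0 1) := by
  have h := intervalIntegral.continuousOn_primitive_interval (μ := volume) (f := kertzKernel c)
    (a := 0) (b := 1)
  rw [Set.uIcc_of_le zero_le_one] at h
  exact h (continuousOn_kertzKernel hc).integrableOn_Icc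

lemma hasDerivAt_kertzTime {c r : ℝ} (hc : 0 < c) (hr : r ∈ Set.Icc (0 : ℝ) 1) :
    HasDerivAt (kertzTime c) (kertzKernel c r) r :=
  intervalIntegral.integral_hasDerivAt_right
    (intervalIntegrable_kertzKernel hc (by simp) hr)
    (measurable_kertzKernel c).stronglyMeasurable.stronglyMeasurableAtFilter
    (continuousAt_kertzKernel hc hr.1 hr.2)

lemma strictMonoOn_kertzTime {c : ℝ} (hc : 0 < c) : StrictMonoOn (kertzTime c) (Set.Icc 0 1) := by
  refine strictMonoOn_of_deriv_pos (convex_Icc 0 1) (continuousOn_kertzTime hc) fun x hx => ?_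
  rw [interior_Icc] at hx
  rw [(hasDerivAt_kertzTime hc ⟨hx.1.le, hx.2.le⟩).deriv]
  exact kertzKernel_pos hc hx.1.le hx.2.le

/-- With `Z s = R ^ (1 / (1 - s))` and `y s = (1 - s) * Z s - c * s`, the curve starts at `y 0 = R`
and has `y' = -(c - Z (log Z - 1))`. Since `y ≤ Z`, monotonicity makes it descend at least as fast
as the flow run backwards from `R`, so `kertzTime c (y s) + s` does not increase. -/
lemma kertzTime_comparison {c R s₀ : ℝ} (hc : 0 < c) (hR : 0 < R) (hR1 : R ≤ 1) (hs₀ : 0 ≤ s₀)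
    (hs₁ : s₀ < 1) (hy : 0 ≤ (1 - s₀) * Real.exp (Real.log R / (1 - s₀)) - c * s₀) :
    (1 - s₀) * Real.exp (Real.log R / (1 - s₀)) - c * s₀ ≤ R ∧
    kertzTime c ((1 - s₀) * Real.exp (Real.log R / (1 - s₀)) - c * s₀) + s₀ ≤ kertzTime c R := by
  set Z : ℝ → ℝ := fun s => Real.exp (Real.log R / (1 - s)) with hZ
  set y : ℝ → ℝ := fun s => (1 - s) * Z s - c * s with hydef
  have hlog : Real.log R ≤ 0 := Real.log_nonpos hR.le hR1
  have hZ0 : ∀ s, 0 < Z s := fun s => Real.exp_pos _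
  have hZ1 : ∀ s < 1, Z s ≤ 1 := fun s hs =>
    Real.exp_le_one_iff.2 (div_nonpos_of_nonpos_of_nonneg hlog (by linarith))
  have hder : ∀ s < 1, HasDerivAt y (-(c - Z s * (Real.log (Z s) - 1))) s := by
    intro s hs
    have h1s : (1 : ℝ) - s ≠ 0 := by linarith
    have h1 : HasDerivAt (fun s : ℝ => 1 - s) (-1) s := by
      simpa using (hasDerivAt_id s).const_sub 1
    have h2 : HasDerivAt Z (Z s * (Real.log R / (1 - s) ^ 2)) s := by
      have := ((hasDerivAt_const s (Real.log R)).fun_div h1 h1s).exp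
      convert this using 1
      simp [hZ]
    have h3 := (h1.mul h2).sub ((hasDerivAt_id s).const_mul c)
    refine h3.congr_deriv ?_
    have : Real.log (Z s) = Real.log R / (1 - s) := Real.log_exp _
    rw [this]
    field_simp
    ring
  have hanti : StrictAntiOn y (Set.Icc 0 s₀) := by
    refine strictAntiOn_of_deriv_neg (convex_Icc _ _)
      (fun s hs => (hder s (hs.2.trans_lt hs₁)).continuousAt.continuousWithinAt) fun s hs => ?_
    rw [interior_Icc] at hs
    have hs1 : s < 1 := hs.2.trans hs₁
    rw [(hder s hs1).deriv]
    exact neg_neg_of_pos (kertzDenom_pos hc (hZ0 s).le (hZ1 s hs1))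
  have hy00 : y 0 = R := by simp [hydef, hZ, Real.exp_log hR]
  have hmem : ∀ s ∈ Set.Icc 0 s₀, y s ∈ Set.Icc (0 : ℝ) 1 := fun s hs =>
    ⟨hy.trans (hanti.antitoneOn hs ⟨hs₀, le_rfl⟩ hs.2),
      (hanti.antitoneOn ⟨le_rfl, hs₀⟩ hs hs.1).trans (hy00.trans_le hR1)⟩
  have hcontT : ContinuousOn (fun s => kertzTime c (y s) + s) (Set.Icc 0 s₀) :=
    ((continuousOn_kertzTime hc).comp
      (fun s hs => (hder s (hs.2.trans_lt hs₁)).continuousAt.continuousWithinAt) hmem).add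
      continuousOn_id
  have hderT : ∀ s ∈ Set.Ioo 0 s₀, HasDerivAt (fun s => kertzTime c (y s) + s)
      (kertzKernel c (y s) * -(c - Z s * (Real.log (Z s) - 1)) + 1) s := fun s hs =>
    ((hasDerivAt_kertzTime hc (hmem s ⟨hs.1.le, hs.2.le⟩)).comp s
      (hder s (hs.2.trans hs₁))).add (hasDerivAt_id s)
  have hmono : AntitoneOn (fun s => kertzTime c (y s) + s) (Set.Icc 0 s₀) := by
    refine antitoneOn_of_deriv_nonpos (convex_Icc _ _) hcontT ?_ ?_
    · rw [interior_Icc]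
      exact fun s hs => (hderT s hs).differentiableAt.differentiableWithinAt
    · rw [interior_Icc]
      intro s hs
      rw [(hderT s hs).deriv]
      have hs1 : s < 1 := hs.2.trans hs₁
      have hm := hmem s ⟨hs.1.le, hs.2.le⟩
      have hpos : 0 < y s := hy.trans_lt
        (hanti ⟨hs.1.le, hs.2.le⟩ ⟨hs₀, le_rfl⟩ hs.2)
      have hyZ : y s ≤ Z s := by
        have := mul_nonneg hs.1.le (hZ0 s).le
        have := mul_nonneg hc.le hs.1.le
        simp only [hydef]
        linarith
      have hfz := sub_mul_log_mono hpos hyZ (hZ1 s hs1)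
      have hd := kertzDenom_pos hc hm.1 hm.2
      have : 1 ≤ kertzKernel c (y s) * (c - Z s * (Real.log (Z s) - 1)) := by
        rw [kertzKernel, inv_mul_eq_div, one_le_div hd]
        linarith
      linarith
  refine ⟨(hanti.antitoneOn ⟨le_rfl, hs₀⟩ ⟨hs₀, le_rfl⟩ hs₀).trans_eq hy00, ?_⟩
  have h := hmono ⟨le_rfl, hs₀⟩ ⟨hs₀, le_rfl⟩ hs₀
  simpa [hy00] using h

/-- The levels reached by the solution of Kertz's equation after `k / n` units of time dominate the
recursion for the tangent points in the prophet inequality. -/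
lemma exists_kertz_levels {c : ℝ} (hc : 0 < c) (hT : kertzTime c 1 = 1) {n : ℕ} (hn : 2 ≤ n) :
    ∃ ρ p : ℕ → ℝ, ρ 0 = 0 ∧ ρ n = 1 ∧ ∀ k < n, 0 ≤ p k ∧ p k ^ (n - 1) = ρ (k + 1) ∧
      (n - 1 : ℝ) * p k ^ n ≤ c + n * ρ k := by
  have hn0 : (0 : ℝ) < n := by positivity
  have hn1 : (1 : ℝ) < n := by exact_mod_cast hn
  -- Only indices up to `n` matter; beyond them the level defaults to `0`.
  have hex : ∀ k : ℕ, ∃ r ∈ Set.Icc (0 : ℝ) 1, k ≤ n → kertzTime c r = k / n := by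
    intro k
    by_cases hk : k ≤ n
    · obtain ⟨r, hr, hr1⟩ := intermediate_value_Icc zero_le_one (continuousOn_kertzTime hc)
        (show (k / n : ℝ) ∈ _ from by
          rw [kertzTime_zero, hT]
          exact ⟨by positivity, div_le_one_of_le₀ (by exact_mod_cast hk) hn0.le⟩)
      exact ⟨r, hr, fun _ => hr1⟩
    · exact ⟨0, by simp, fun h => absurd h hk⟩
  choose ρ hρ hρT using hex
  have hinj := (strictMonoOn_kertzTime hc).injOn
  have hcast : ((n - 1 : ℕ) : ℝ) = n - 1 := by push_cast [show 1 ≤ n by omega]; ring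
  refine ⟨ρ, fun k => Real.exp (Real.log (ρ (k + 1)) / (n - 1)), ?_, ?_, fun k hk =>
    ⟨(Real.exp_pos _).le, ?_, ?_⟩⟩
  · exact hinj (hρ 0) (by simp) (by simp [hρT 0, kertzTime_zero])
  · exact hinj (hρ n) (by simp) (by rw [hρT n le_rfl, hT, div_self hn0.ne'])
  all_goals
    have hpos : 0 < ρ (k + 1) := by
      refine (hρ (k + 1)).1.lt_of_ne' fun h => ?_
      have := hρT (k + 1) hk
      rw [h, kertzTime_zero] at this
      have h2 : (0 : ℝ) < ((k + 1 : ℕ) : ℝ) / n := by positivity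
      linarith
  · rw [← Real.exp_nat_mul, hcast, mul_div_cancel₀ _ (by linarith), Real.exp_log hpos]
  · have hs : (1 : ℝ) - 1 / n = (n - 1) / n := by field_simp
    have hZ : Real.exp (Real.log (ρ (k + 1)) / (n - 1)) ^ n =
        Real.exp (Real.log (ρ (k + 1)) / (1 - 1 / n)) := by
      rw [← Real.exp_nat_mul, hs]
      congr 1
      have : (n : ℝ) - 1 ≠ 0 := by linarith
      field_simp
    rw [hZ]
    set E := Real.exp (Real.log (ρ (k + 1)) / (1 - 1 / n)) with hE
    suffices h : (1 - 1 / (n : ℝ)) * E - c * (1 / n) ≤ ρ k by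
      rw [hs] at h
      have := mul_le_mul_of_nonneg_left h hn0.le
      have h2 : (n : ℝ) * ((n - 1) / n * E - c * (1 / n)) = (n - 1) * E - c := by field_simp
      linarith
    -- The comparison needs a nonnegative endpoint; a negative one lies below `ρ k ≥ 0` anyway.
    by_cases hy : 0 ≤ (1 - 1 / (n : ℝ)) * E - c * (1 / n)
    · obtain ⟨h1, h2⟩ := kertzTime_comparison hc hpos (hρ (k + 1)).2
        (by positivity) ((div_lt_one hn0).2 hn1) hy
      by_contra! hlt
      have h3 := strictMonoOn_kertzTime hc (hρ k) ⟨hy, h1.trans (hρ (k + 1)).2⟩ hlt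
      rw [hρT k hk.le] at h3
      rw [hρT (k + 1) hk] at h2
      have : (((k + 1 : ℕ) : ℝ)) / n = k / n + 1 / n := by push_cast; ring
      linarith
    · linarith [(hρ k).1]

/-! ### Optimal stopping by backward induction. -/

section Dynamic

variable {Ω : Type*} [MeasurableSpace Ω] (μ : Measure Ω) (Y : Ω → ℝ≥0)

/-- The value of optimally stopping `k` independent copies of `Y`. -/
noncomputable def stoppingValue : ℕ → ℝ≥0∞
  | 0 => 0
  | k + 1 => ∫⁻ ω, max (Y ω : ℝ≥0∞) (stoppingValue k) ∂μ

/-- The policy that accepts a box as soon as its content is at least the value of continuing. -/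
noncomputable def thresholdPolicy (n : ℕ) : Policy n where
  accept t := {h | stoppingValue μ Y (n - 1 - t) ≤ ((h (Fin.last t)).2 : ℝ≥0∞)}
  measurableSet_accept t := by
    refine measurableSet_le measurable_const ?_
    fun_prop

variable {μ Y}

lemma thresholdPolicy_stopsAt_iff {n : ℕ} (π : Equiv.Perm (Fin n)) (x : Fin n → ℝ≥0) (t : Fin n) :
    (thresholdPolicy μ Y n).StopsAt π x t ↔
      stoppingValue μ Y (n - 1 - t) ≤ (x (π t) : ℝ≥0∞) ∧
        ∀ s < t, (x (π s) : ℝ≥0∞) < stoppingValue μ Y (n - 1 - s) := by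
  have h : ∀ s : Fin n, history π x s ∈ (thresholdPolicy μ Y n).accept s ↔
      stoppingValue μ Y (n - 1 - s) ≤ (x (π s) : ℝ≥0∞) := fun s => Iff.rfl
  simp only [Policy.StopsAt, h, not_le]

open Classical in
/-- The contribution of the box with arrival index `s` to the reward for stopping at `t`, when the
threshold at arrival index `k` is `v k`. -/
noncomputable def stopFactor (v : ℕ → ℝ≥0∞) (t s : ℕ) (y : ℝ≥0) : ℝ≥0∞ :=
  if s < t then (if (y : ℝ≥0∞) < v s then 1 else 0)
  else if s = t then (if v t ≤ (y : ℝ≥0∞) then (y : ℝ≥0∞) else 0) else 1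

lemma measurable_stopFactor (v : ℕ → ℝ≥0∞) (t s : ℕ) : Measurable (stopFactor v t s) := by
  have hm : Measurable fun y : ℝ≥0 => (y : ℝ≥0∞) := measurable_coe_nnreal_ennreal
  unfold stopFactor
  split_ifs
  · exact Measurable.ite (measurableSet_lt hm measurable_const) measurable_const measurable_const
  · exact Measurable.ite (measurableSet_le measurable_const hm) hm measurable_const
  · exact measurable_const

lemma prod_fin_ite {M : Type*} [CommMonoid M] (a : ℕ → M) (b : M) {n t : ℕ} (ht : t < n) :
    ∏ s : Fin n, (if (s : ℕ) < t then a s else if (s : ℕ) = t then b else 1) =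
      (∏ s ∈ Finset.range t, a s) * b := by
  rw [Fin.prod_univ_eq_prod_range (fun s => if s < t then a s else if s = t then b else 1) n,
    ← Finset.prod_subset (Finset.range_subset_range.2 ht), Finset.prod_range_succ]
  · congr 1
    · exact Finset.prod_congr rfl fun s hs => if_pos (Finset.mem_range.1 hs)
    · simp
  · intro s _ hs
    rw [Finset.mem_range] at hs
    rw [if_neg (by omega), if_neg (by omega)]

/-- Stopping at `t` imposes one condition on each box that has arrived, so the reward factorises
over arrival indices and independence applies. -/
lemma thresholdPolicy_reward {n : ℕ} (π : Equiv.Perm (Fin n)) (x : Fin n → ℝ≥0) :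
    (thresholdPolicy μ Y n).reward π x =
      ∑ t : Fin n, ∏ s : Fin n,
        stopFactor (fun k => stoppingValue μ Y (n - 1 - k)) t s (x (π s)) := by
  classical
  refine Finset.sum_congr rfl fun t _ => ?_
  simp only [thresholdPolicy_stopsAt_iff]
  split_ifs with h
  · have h1 : ∀ s : Fin n, stopFactor (fun k => stoppingValue μ Y (n - 1 - k)) t s (x (π s)) =
        if s = t then (x (π t) : ℝ≥0∞) else 1 := by
      intro s
      unfold stopFactor
      rcases lt_trichotomy s t with hs | rfl | hs
      · rw [if_pos (Fin.lt_def.1 hs), if_pos (h.2 s hs), if_neg hs.ne]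
      · rw [if_neg (lt_irrefl _), if_pos rfl, if_pos h.1, if_pos rfl]
      · rw [if_neg (Fin.lt_def.1 hs).not_gt, if_neg (Fin.lt_def.1 hs).ne', if_neg hs.ne']
    simp [h1]
  · symm
    by_cases h1 : stoppingValue μ Y (n - 1 - t) ≤ (x (π t) : ℝ≥0∞)
    · simp only [h1, true_and, not_forall] at h
      obtain ⟨s, hs, h2⟩ := h
      exact Finset.prod_eq_zero (Finset.mem_univ s) (by
        rw [stopFactor, if_pos (Fin.lt_def.1 hs), if_neg h2])
    · exact Finset.prod_eq_zero (Finset.mem_univ t) (by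
        rw [stopFactor, if_neg (lt_irrefl _), if_pos rfl, if_neg h1])

open Classical in
lemma lintegral_max_const (hY : Measurable Y) (v : ℝ≥0∞) :
    ∫⁻ ω, max (Y ω : ℝ≥0∞) v ∂μ =
      (∫⁻ ω, if v ≤ (Y ω : ℝ≥0∞) then (Y ω : ℝ≥0∞) else 0 ∂μ) +
        (∫⁻ ω, if (Y ω : ℝ≥0∞) < v then 1 else 0 ∂μ) * v := by
  have hm : Measurable fun ω => (Y ω : ℝ≥0∞) := hY.coe_nnreal_ennreal
  have h1 : Measurable fun ω => if (Y ω : ℝ≥0∞) < v then (1 : ℝ≥0∞) else 0 :=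
    Measurable.ite (measurableSet_lt hm measurable_const) measurable_const measurable_const
  rw [← lintegral_mul_const _ h1, ← lintegral_add_right _ (h1.mul_const v)]
  refine lintegral_congr fun ω => ?_
  rcases lt_or_ge (Y ω : ℝ≥0∞) v with h | h
  · simp [h, h.le, h.not_ge]
  · simp [h, h.not_gt]

/-- The backward recursion unrolled over the first `m` arrivals: the last summand is the probability
of having rejected them all times the value of continuing. -/
lemma sum_prod_add_eq {a b v : ℕ → ℝ≥0∞} {n : ℕ}
    (h : ∀ k < n, b k + a k * v (n - 1 - k) = v (n - k)) :
    ∀ m ≤ n, ∑ t ∈ Finset.range m, (∏ s ∈ Finset.range t, a s) * b t +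
      (∏ s ∈ Finset.range m, a s) * v (n - m) = v n := by
  intro m
  induction m with
  | zero => simp
  | succ m ih =>
    intro hm
    rw [← ih (by omega), ← h m hm, Finset.sum_range_succ, Finset.prod_range_succ,
      show n - (m + 1) = n - 1 - m by omega]
    ring

lemma lintegral_thresholdPolicy_reward [IsProbabilityMeasure μ] {n : ℕ} {X : Fin n → Ω → ℝ≥0}
    (hX : ∀ i, Measurable (X i)) (hY : Measurable Y) (hind : iIndepFun X μ)
    (hid : ∀ i, IdentDistrib (X i) Y μ μ) (π : Equiv.Perm (Fin n)) :
    ∫⁻ ω, (thresholdPolicy μ Y n).reward π (fun i => X i ω) ∂μ = stoppingValue μ Y n := by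
  classical
  set v : ℕ → ℝ≥0∞ := fun k => stoppingValue μ Y (n - 1 - k) with hv
  have hmeas : ∀ t s : Fin n, Measurable fun ω => stopFactor v t s (X (π s) ω) := fun t s =>
    (measurable_stopFactor v t s).comp (hX _)
  simp only [thresholdPolicy_reward]
  rw [lintegral_finsetSum _ fun t _ => Finset.measurable_prod _ fun s _ => hmeas t s]
  set a : ℕ → ℝ≥0∞ := fun k => ∫⁻ ω, if (Y ω : ℝ≥0∞) < v k then 1 else 0 ∂μ with ha
  set b : ℕ → ℝ≥0∞ := fun k => ∫⁻ ω, if v k ≤ (Y ω : ℝ≥0∞) then (Y ω : ℝ≥0∞) else 0 ∂μ with hb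
  have hterm : ∀ t : Fin n, ∫⁻ ω, ∏ s : Fin n, stopFactor v t s (X (π s) ω) ∂μ =
      (∏ s ∈ Finset.range t, a s) * b t := by
    intro t
    rw [lintegral_prod_eq_prod_lintegral_of_indepFun Finset.univ
      (fun (s : Fin n) ω => stopFactor v t s (X (π s) ω))
      ((hind.precomp π.injective).comp (fun s : Fin n => stopFactor v t s)
        fun s => measurable_stopFactor v t s) (hmeas t), ← prod_fin_ite a (b t) t.isLt]
    refine Finset.prod_congr rfl fun s _ => ?_
    have h := ((hid (π s)).comp (measurable_stopFactor v t s)).lintegral_eq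
    simp only [Function.comp_apply] at h
    rw [h]
    unfold stopFactor
    split_ifs <;> simp [ha, hb]
  rw [Finset.sum_congr rfl fun t _ => hterm t,
    Fin.sum_univ_eq_sum_range (fun t => (∏ s ∈ Finset.range t, a s) * b t) n]
  have h := sum_prod_add_eq (a := a) (b := b) (v := stoppingValue μ Y) (n := n) (fun k hk => by
    rw [show n - k = n - 1 - k + 1 by omega]
    exact (lintegral_max_const hY _).symm) n le_rfl
  -- After all `n` arrivals the value of continuing is `stoppingValue μ Y 0 = 0`.
  simpa [stoppingValue] using h

theorem stoppingValue_le_OPT [IsProbabilityMeasure μ] {n : ℕ} {X : Fin n → Ω → ℝ≥0}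
    (hX : ∀ i, Measurable (X i)) (hY : Measurable Y) (hind : iIndepFun X μ)
    (hid : ∀ i, IdentDistrib (X i) Y μ μ) : stoppingValue μ Y n ≤ OPT μ X := by
  refine le_trans (le_of_eq ?_) (le_iSup _ (thresholdPolicy μ Y n))
  simp only [Policy.expectedReward, lintegral_thresholdPolicy_reward hX hY hind hid,
    Finset.sum_const, Finset.card_univ, Fintype.card_perm, Fintype.card_fin, nsmul_eq_mul]
  rw [← mul_assoc, ENNReal.inv_mul_cancel (by simp [n.factorial_ne_zero]) (by simp), one_mul]

end Dynamic

/-! ### The tangent argument for tail integrals. -/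

/-- Bernoulli's inequality for `a / p`, scaled by `p ^ n`; `p = 0` is separate. -/
lemma pow_ge_tangent {a p : ℝ} (ha : 0 ≤ a) (hp : 0 ≤ p) {n : ℕ} (hn : 1 ≤ n) :
    p ^ n + n * p ^ (n - 1) * (a - p) ≤ a ^ n := by
  obtain ⟨m, rfl⟩ := Nat.exists_eq_add_of_le' hn
  rw [Nat.add_sub_cancel]
  rcases hp.eq_or_lt with rfl | hp
  · rcases m.eq_zero_or_pos with rfl | hm
    · simp
    · simp [hm.ne', pow_nonneg ha]
  · have h := one_add_mul_le_pow (a := a / p - 1)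
      (by linarith [div_nonneg ha hp.le]) (m + 1)
    rw [add_sub_cancel, div_pow, le_div_iff₀ (by positivity)] at h
    refine le_trans (le_of_eq ?_) h
    field_simp
    ring

section Tail

variable {G : ℝ → ℝ}

lemma one_sub_pow_le {n : ℕ} {g : ℝ} (h1 : g ≤ 1) : 1 - (1 - g) ^ n ≤ n * g := by
  have := one_add_mul_le_pow (a := -g) (by linarith) n
  rw [← sub_eq_add_neg] at this
  linarith

lemma integrableOn_one_sub_pow (h0 : ∀ x, 0 ≤ G x) (h1 : ∀ x, G x ≤ 1)
    (hG : IntegrableOn G (Set.Ioi 0)) (n : ℕ) :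
    IntegrableOn (fun x => 1 - (1 - G x) ^ n) (Set.Ioi 0) := by
  refine (hG.const_mul (n : ℝ)).mono' ?_ (.of_forall fun x => ?_)
  · exact (by fun_prop : Continuous fun g : ℝ => 1 - (1 - g) ^ n).comp_aestronglyMeasurable hG.1
  · rw [Real.norm_of_nonneg (sub_nonneg.2 (pow_le_one₀ (sub_nonneg.2 (h1 x))
      (by linarith [h0 x])))]
    exact one_sub_pow_le (h1 x)

lemma setIntegral_Ioi_sub {f : ℝ → ℝ} (hf : IntegrableOn f (Set.Ioi 0)) {a b : ℝ} (ha : 0 ≤ a)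
    (hab : a ≤ b) :
    ∫ x in Set.Ioi a, f x = (∫ x in Set.Ioc a b, f x) + ∫ x in Set.Ioi b, f x := by
  have hs : Set.Ioi a ⊆ Set.Ioi (0 : ℝ) := Set.Ioi_subset_Ioi ha
  rw [← Set.Ioc_union_Ioi_eq_Ioi hab]
  exact setIntegral_union (Set.Ioc_disjoint_Ioi le_rfl) measurableSet_Ioi
    (hf.mono_set (Set.Ioc_subset_Ioi_self.trans hs))
    (hf.mono_set (Set.Ioi_subset_Ioi (ha.trans hab)))

/-- The tail form of the prophet inequality for independent identically distributed variables whose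
common tail function is `G`. -/
theorem integral_tail_max_le {c : ℝ} (hc : 0 < c) (hT : kertzTime c 1 = 1) {n : ℕ} (hn : 2 ≤ n)
    (h0 : ∀ x, 0 ≤ G x) (h1 : ∀ x, G x ≤ 1) (hG : IntegrableOn G (Set.Ioi 0)) {V : ℕ → ℝ}
    (hV0 : V 0 = 0) (hV : ∀ k, V (k + 1) = V k + ∫ x in Set.Ioi (V k), G x) :
    ∫ x in Set.Ioi 0, (1 - (1 - G x) ^ n) ≤ (1 + c) * V n := by
  obtain ⟨ρ, p, hρ0, hρn, hp⟩ := exists_kertz_levels hc hT hn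
  set D : ℝ → ℝ := fun v => ∫ x in Set.Ioi v, G x with hD
  set M : ℝ → ℝ := fun v => ∫ x in Set.Ioi v, (1 - (1 - G x) ^ n) with hM
  have hH := integrableOn_one_sub_pow h0 h1 hG n
  have hD0 : ∀ v, 0 ≤ D v := fun v => setIntegral_nonneg measurableSet_Ioi fun x _ => h0 x
  have hstep : ∀ k, V k ≤ V (k + 1) := fun k => by linarith [hV k, hD0 (V k)]
  have hVnn : ∀ k, 0 ≤ V k := fun k => hV0 ▸ monotone_nat_of_le_succ hstep k.zero_le
  -- Beyond `V n` Bernoulli suffices; its slope `n = n * ρ n` cancels the term left by telescoping.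
  have hlast : M (V n) ≤ n * D (V n) := by
    simp only [hM, hD]
    rw [← integral_const_mul]
    have hs : Set.Ioi (V n) ⊆ Set.Ioi (0 : ℝ) := Set.Ioi_subset_Ioi (hVnn n)
    exact integral_mono (hH.mono_set hs) ((hG.mono_set hs).const_mul _)
      fun x => one_sub_pow_le (h1 x)
  have hincr : ∀ k < n, M (V k) - M (V (k + 1)) ≤
      (1 + c) * (V (k + 1) - V k) + n * ρ k * D (V k) - n * ρ (k + 1) * D (V (k + 1)) := by
    intro k hk
    obtain ⟨hp0, hpρ, hpc⟩ := hp k hk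
    have hs : Set.Ioc (V k) (V (k + 1)) ⊆ Set.Ioi (0 : ℝ) :=
      Set.Ioc_subset_Ioi_self.trans (Set.Ioi_subset_Ioi (hVnn k))
    have hM' : M (V k) - M (V (k + 1)) =
        ∫ x in Set.Ioc (V k) (V (k + 1)), (1 - (1 - G x) ^ n) := by
      simp only [hM]
      linarith [setIntegral_Ioi_sub hH (hVnn k) (hstep k)]
    have hD' : ∫ x in Set.Ioc (V k) (V (k + 1)), G x = D (V k) - D (V (k + 1)) := by
      simp only [hD]
      linarith [setIntegral_Ioi_sub hG (hVnn k) (hstep k)]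
    have hbound : ∫ x in Set.Ioc (V k) (V (k + 1)), (1 - (1 - G x) ^ n) ≤
        ∫ x in Set.Ioc (V k) (V (k + 1)),
          ((1 - p k ^ n - n * ρ (k + 1) * (1 - p k)) + n * ρ (k + 1) * G x) := by
      refine integral_mono (hH.mono_set hs)
        ((integrable_const _).add ((hG.mono_set hs).const_mul _)) fun x => ?_
      have := pow_ge_tangent (sub_nonneg.2 (h1 x)) hp0 (by omega : 1 ≤ n)
      rw [hpρ] at this
      simp only
      linarith
    rw [integral_add (integrable_const _) ((hG.mono_set hs).const_mul _), integral_const_mul, hD',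
      setIntegral_const, Real.volume_real_Ioc_of_le (hstep k), smul_eq_mul] at hbound
    have hpn : p k ^ n = ρ (k + 1) * p k := by
      rw [← hpρ, ← pow_succ, Nat.sub_add_cancel (by omega)]
    -- Since `ρ (k+1) * p k = p k ^ n`, the coefficient of `D (V k)` in the tangent bound is `1 +
    -- (n-1) * p k ^ n`, which `hpc` bounds by `1 + c + n * ρ k`.
    have hkey := mul_le_mul_of_nonneg_right hpc (hD0 (V k))
    have hVk : V (k + 1) - V k = D (V k) := by rw [hV k]; ring
    rw [hVk] at hbound ⊢
    rw [hM']
    rw [hpn] at hkey hbound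
    linarith
  have hsum : ∀ k ≤ n, M 0 - M (V k) ≤ (1 + c) * V k - n * ρ k * D (V k) := by
    intro k
    induction k with
    | zero => simp [hV0, hρ0]
    | succ k ih => intro hk; linarith [ih (by omega), hincr k (by omega)]
  have h := hsum n le_rfl
  rw [hρn] at h
  change M 0 ≤ _
  linarith

end Tail

/-! ### Layer-cake formulas and the conclusion. -/

section Probability

variable {Ω : Type*} [MeasurableSpace Ω] {μ : Measure Ω} [IsProbabilityMeasure μ] {Y : Ω → ℝ≥0}

lemma integrableOn_tail (hY : Measurable Y) (hfin : ∫⁻ ω, Y ω ∂μ ≠ ∞) :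
    IntegrableOn (fun x : ℝ => μ.real {ω | x < Y ω}) (Set.Ioi 0) := by
  have hanti : Antitone fun x : ℝ => μ.real {ω | x < Y ω} := fun x y hxy =>
    measureReal_mono fun ω (hω : y < Y ω) => hxy.trans_lt hω
  refine ⟨hanti.measurable.aestronglyMeasurable, ?_⟩
  rw [hasFiniteIntegral_iff_ofReal (.of_forall fun x => measureReal_nonneg)]
  rw [lintegral_congr fun x => ofReal_measureReal, ← lintegral_eq_lintegral_meas_lt μ (.of_forall fun ω => (Y ω).coe_nonneg)
    hY.coe_nnreal_real.aemeasurable]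
  simpa using hfin.lt_top

lemma lintegral_max_ofReal (hY : Measurable Y) (hfin : ∫⁻ ω, Y ω ∂μ ≠ ∞) {v : ℝ} (hv : 0 ≤ v) :
    ∫⁻ ω, max (Y ω : ℝ≥0∞) (ENNReal.ofReal v) ∂μ =
      ENNReal.ofReal (v + ∫ x in Set.Ioi v, μ.real {ω | x < Y ω}) := by
  have h1 : ∀ ω, max (Y ω : ℝ≥0∞) (ENNReal.ofReal v) = ENNReal.ofReal (max (Y ω : ℝ) v) :=
    fun ω => by rw [ENNReal.ofReal_max, ENNReal.ofReal_coe_nnreal]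
  simp only [h1]
  rw [lintegral_eq_lintegral_meas_lt μ (.of_forall fun ω => le_max_of_le_right hv)
    (hY.coe_nnreal_real.max measurable_const).aemeasurable,
    ← Set.Ioc_union_Ioi_eq_Ioi hv, lintegral_union measurableSet_Ioi
      (Set.Ioc_disjoint_Ioi le_rfl),
    ENNReal.ofReal_add hv (setIntegral_nonneg measurableSet_Ioi fun x _ => measureReal_nonneg),
    ofReal_integral_eq_lintegral_ofReal
      ((integrableOn_tail hY hfin).mono_set (Set.Ioi_subset_Ioi hv))
      (.of_forall fun x => measureReal_nonneg)]
  congr 1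
  -- Below `v` the event is certain; at `x = v` it need not be, hence only almost everywhere.
  · rw [setLIntegral_congr_fun_ae (g := fun _ => 1) measurableSet_Ioc]
    · simp
    · filter_upwards [Measure.ae_ne volume v] with x hxv hx
      have : {ω | x < max (Y ω : ℝ) v} = Set.univ := by
        ext ω
        simp [lt_of_le_of_ne hx.2 hxv]
      rw [this, measure_univ]
  · refine setLIntegral_congr_fun measurableSet_Ioi fun x (hx : v < x) => ?_
    simp only [lt_max_iff, hx.not_gt, or_false]
    exact (ofReal_measureReal).symm

/-- Layer cake: by independence the maximum is at most `x` with probability `(1 - G x) ^ n`. -/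
lemma MAX_eq_integral_tail {n : ℕ} {X : Fin n → Ω → ℝ≥0} (hX : ∀ i, Measurable (X i))
    (hY : Measurable Y) (hfin : ∫⁻ ω, Y ω ∂μ ≠ ∞) (hind : iIndepFun X μ)
    (hid : ∀ i, IdentDistrib (X i) Y μ μ) :
    MAX μ X = ENNReal.ofReal (∫ x in Set.Ioi (0 : ℝ), (1 - (1 - μ.real {ω | x < Y ω}) ^ n)) := by
  have hsup : ∀ ω, (⨆ i, (X i ω : ℝ≥0∞)) =
      ENNReal.ofReal ((Finset.univ.sup fun i => X i ω : ℝ≥0) : ℝ) := fun ω => by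
    rw [ENNReal.ofReal_coe_nnreal, ENNReal.coe_finset_sup, Finset.sup_univ_eq_iSup]
  have hmeas : Measurable fun ω => Finset.univ.sup fun i => X i ω := by
    induction (Finset.univ : Finset (Fin n)) using Finset.cons_induction with
    | empty => exact measurable_const
    | cons i s hi ih => simpa only [Finset.sup_cons] using (hX i).max ih
  have h0 : ∀ x : ℝ, 0 ≤ 1 - (1 - μ.real {ω | x < Y ω}) ^ n := fun x =>
    sub_nonneg.2 (pow_le_one₀ (sub_nonneg.2 measureReal_le_one)
      (by linarith [measureReal_nonneg (μ := μ) (s := {ω | x < (Y ω : ℝ)})]))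
  simp only [MAX, hsup]
  rw [lintegral_eq_lintegral_meas_lt μ (.of_forall fun ω => NNReal.coe_nonneg _)
    hmeas.coe_nnreal_real.aemeasurable,
    ofReal_integral_eq_lintegral_ofReal (integrableOn_one_sub_pow (fun _ => measureReal_nonneg)
      (fun _ => measureReal_le_one) (integrableOn_tail hY hfin) n) (.of_forall h0)]
  refine setLIntegral_congr_fun measurableSet_Ioi fun x (hx : 0 < x) => ?_
  lift x to ℝ≥0 using hx.le
  have hset : {ω | (x : ℝ) < (Finset.univ.sup fun i => X i ω : ℝ≥0)} =
      (⋂ i ∈ (Finset.univ : Finset (Fin n)), X i ⁻¹' Set.Iic x)ᶜ := by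
    ext ω
    simp only [Set.mem_ofPred_eq, Set.mem_compl_iff, Set.mem_iInter,
      Set.mem_preimage, Set.mem_Iic, ← not_le, NNReal.coe_le_coe, Finset.sup_le_iff]
  have hYset : {ω | (x : ℝ) < Y ω} = (Y ⁻¹' Set.Iic x)ᶜ := by
    ext ω
    simp
  have hm : MeasurableSet (⋂ i ∈ (Finset.univ : Finset (Fin n)), X i ⁻¹' Set.Iic x) :=
    Finset.measurableSet_biInter _ fun i _ => hX i measurableSet_Iic
  rw [hset, hYset, ← ofReal_measureReal, probReal_compl_eq_one_sub hm,
    probReal_compl_eq_one_sub (hY measurableSet_Iic), sub_sub_cancel, measureReal_def,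
    hind.measure_inter_preimage_eq_mul _ fun i _ => measurableSet_Iic,
    Finset.prod_congr rfl fun i _ => (hid i).measure_mem_eq measurableSet_Iic]
  simp [measureReal_def]

theorem ofReal_mul_MAX_le_OPT {β : ℝ} (hβ : IsKertzBound β) {n : ℕ} {X : Fin n → Ω → ℝ≥0}
    (hX : ∀ i, Measurable (X i)) (hind : iIndepFun X μ)
    (hid : ∀ i j, IdentDistrib (X i) (X j) μ μ) :
    ENNReal.ofReal β * MAX μ X ≤ OPT μ X := by
  obtain ⟨hβ0, hβ1, hβT⟩ := hβ
  rcases n with _ | m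
  · simp [MAX]
  set Y := X 0 with hYdef
  have hY : Measurable Y := hX 0
  have hidY : ∀ i, IdentDistrib (X i) Y μ μ := fun i => hid i 0
  refine le_trans ?_ (stoppingValue_le_OPT hX hY hind hidY)
  -- The exponent `1 / (n-1)` in the levels forces `n ≥ 2`; for a single box, stopping already earns
  -- `MAX`.
  rcases m with _ | m
  · have h1 : ENNReal.ofReal β ≤ 1 := ENNReal.ofReal_le_one.2 hβ1.le
    refine (mul_le_of_le_one_left' h1).trans (le_of_eq ?_)
    simp [MAX, stoppingValue, hYdef]
  -- With infinite mean the stopping value is already infinite, so the real-valued tail integrals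
  -- are needed only for finite mean.
  by_cases hfin : ∫⁻ ω, Y ω ∂μ = ∞
  · refine le_top.trans (hfin.symm.le.trans ?_)
    exact lintegral_mono fun ω => le_max_left _ _
  set D : ℝ → ℝ := fun v => ∫ x in Set.Ioi v, μ.real {ω | x < (Y ω : ℝ)} with hD
  have hD0 : ∀ v, 0 ≤ D v := fun v =>
    setIntegral_nonneg measurableSet_Ioi fun x _ => measureReal_nonneg
  let V : ℕ → ℝ := fun k => Nat.rec 0 (fun _ v => v + D v) k
  have hVnn : ∀ k, 0 ≤ V k := by
    intro k
    induction k with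
    | zero => exact le_rfl
    | succ k ih => exact add_nonneg ih (hD0 _)
  have hval : ∀ k, stoppingValue μ Y k = ENNReal.ofReal (V k) := by
    intro k
    induction k with
    | zero => simp [stoppingValue, V]
    | succ k ih =>
      rw [stoppingValue, ih, lintegral_max_ofReal hY hfin (hVnn k)]
  have hc : 0 < β⁻¹ - 1 := sub_pos.2 ((one_lt_inv₀ hβ0).2 hβ1)
  have key := integral_tail_max_le hc hβT (n := m + 2) (by omega)
    (fun _ => measureReal_nonneg) (fun _ => measureReal_le_one) (integrableOn_tail hY hfin)
    (V := V) rfl (fun _ => rfl)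
  rw [add_sub_cancel] at key
  rw [MAX_eq_integral_tail hX hY hfin hind hidY, hval, ← ENNReal.ofReal_mul hβ0.le]
  refine ENNReal.ofReal_le_ofReal ((mul_le_mul_of_nonneg_left key hβ0.le).trans_eq ?_)
  rw [← mul_assoc, mul_inv_cancel₀ hβ0.ne', one_mul]

end Probability

end ProphetInequality

theorem corollary3p4 :
    (∃! β : ℝ, ProphetInequality.IsKertzBound β) ∧
    ∀ (β : ℝ), ProphetInequality.IsKertzBound β →
    ∀ {Ω : Type*} [MeasurableSpace Ω] (μ : Measure Ω) [IsProbabilityMeasure μ]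
      (n : ℕ) (X : Fin n → Ω → ℝ≥0),
      (∀ i, Measurable (X i)) →
      iIndepFun X μ →
      (∀ i j, IdentDistrib (X i) (X j) μ μ) →
      ENNReal.ofReal β * ProphetInequality.MAX μ X ≤ ProphetInequality.OPT μ X :=
  ⟨ProphetInequality.existsUnique_isKertzBound, fun _ hβ _ _ _ _ _ _ hX hind hid =>
    ProphetInequality.ofReal_mul_MAX_le_OPT hβ hX hind hid⟩
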